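/- Let $\mathbf H$ be a complex $n_R\times n_T$ matrix with $\operatorname{rank}\mathbf H=n_T$, let $P_1,\dots,P_{n_T}>0$ and let $0\le P_{\mathrm{tot}}\le\sum_{i=1}^{n_T}P_i$. Consider the MIMO channel $\mathbf y=\mathbf H\mathbf x+\mathbf z$, $\mathbf z\sim\mathcal{CN}(0,\mathbf I_{n_R})$, whose capacity under joint total-power and per-antenna-power constraints is $$C=\max\big\{\log\det(\mathbf I_{n_R}+\mathbf H\mathbf Q\mathbf H^{\mathsf H}) : \mathbf Q\ge 0,\ \operatorname{tr}\mathbf Q\le P_{\mathrm{tot}},\ (\mathbf Q)_{ii}\le P_i\ (1\le i\le n_T)\big\},$$ the maximum being over Hermitian positive semidefinite $n_T\times n_T$ matrices $\mathbf Q$. Let $\mathbf K=(\mathbf H^{\mathsf H}\mathbf H)^{1/2}$ be the positive semidefinite square root (invertible, since $\mathbf H$ has full column rank), and for a Hermitian matrix $\mathbf A=\mathbf U\operatorname{diag}(a_1,\dots,a_n)\mathbf U^{\mathsf H}$ with $\mathbf U$ unitary let $(\mathbf A)_+=\mathbf U\operatorname{diag}(\max(0,a_1),\dots,\max(0,a_n))\mathbf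 U^{\mathsf H}$. Then the maximum $C$ is attained at exactly one matrix $\mathbf Q_{\mathrm{opt}}$, and $\operatorname{tr}\mathbf Q_{\mathrm{opt}}=P_{\mathrm{tot}}$. Moreover, the optimization problem over real diagonal matrices $\check{\mathbf D}=\operatorname{diag}(d_1,\dots,d_{n_T})$ $$\begin{aligned}\min_{\check{\mathbf D}}\quad&-\log\det\big[\mathbf I_{n_T}+(\mathbf K\check{\mathbf D}\mathbf K-\mathbf I_{n_T})_+\big]\\ \text{s.t.}\quad&d_i>0,\quad 1\le i\le n_T,\\ &\operatorname{tr}\big[\mathbf K^{-1}(\mathbf K\check{\mathbf D}\mathbf K-\mathbf I_{n_T})_+\mathbf K^{-1}\big]=P_{\mathrm{tot}},\\ &\big(\mathbf K^{-1}(\mathbf K\check{\mathbf D}\mathbf K-\mathbf I_{n_T})_+\mathbf K^{-1}\big)_{ii}\le P_i,\quad 1\le i\le n_T,\end{aligned}$$ has a solution, and for every solution $\check{\mathbf D}_{\mathrm{opt}}$ of it $$\mathbf Q_{\mathrm{opt}}=\mathbf K^{-1}(\mathbf K\check{\mathbf D}_{\mathrm{opt}}\mathbf K-\mathbf I_{n_T})_+\mathbf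 K^{-1},\qquad C=\log\det\big[\mathbf I_{n_T}+(\mathbf K\check{\mathbf D}_{\mathrm{opt}}\mathbf K-\mathbf I_{n_T})_+\big].$$ -/

import Mathlib

namespace MIMO

open scoped ComplexOrder MatrixOrder Matrix

/-- The positive part `A⁺` of a Hermitian matrix (given by the functional calculus) is the
matrix obtained by replacing each eigenvalue `x` by `max 0 x`, in any unitary factorization
`A = U diag(a) Uᴴ`. -/
theorem posPart_unitary_conj {n : ℕ} (U : Matrix (Fin n) (Fin n) ℂ)
    (hU : U ∈ Matrix.unitaryGroup (Fin n) ℂ) (a : Fin n → ℝ) :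
    (U * Matrix.diagonal (fun i => (a i : ℂ)) * Uᴴ)⁺ =
      U * Matrix.diagonal (fun i => ((max 0 (a i) : ℝ) : ℂ)) * Uᴴ := by
  have hUU : Uᴴ * U = 1 := Matrix.mem_unitaryGroup_iff'.mp hU
  have key : ∀ b : Fin n → ℝ, (∀ i, 0 ≤ b i) →
      0 ≤ U * Matrix.diagonal (fun i => (b i : ℂ)) * Uᴴ := by
    intro b hb
    rw [Matrix.nonneg_iff_posSemidef]
    refine Matrix.PosSemidef.mul_mul_conjTranspose_same ?_ U
    exact Matrix.PosSemidef.diagonal (fun i => by simpa using hb i)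
  refine (CFC.posPart_negPart_unique
    (b := U * Matrix.diagonal (fun i => ((max 0 (a i) : ℝ) : ℂ)) * Uᴴ)
    (c := U * Matrix.diagonal (fun i => ((max 0 (- a i) : ℝ) : ℂ)) * Uᴴ) ?_ ?_ ?_ ?_).1
  · rw [← sub_mul, ← mul_sub, Matrix.diagonal_sub]
    congr 3
    funext i
    rcases le_total 0 (a i) with h | h
    · simp [h]
    · simp [h]
  · have : U * Matrix.diagonal (fun i => ((max 0 (a i) : ℝ) : ℂ)) * Uᴴ *
        (U * Matrix.diagonal (fun i => ((max 0 (- a i) : ℝ) : ℂ)) * Uᴴ) =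
        U * (Matrix.diagonal (fun i => ((max 0 (a i) : ℝ) : ℂ)) * (Uᴴ * U) *
          Matrix.diagonal (fun i => ((max 0 (- a i) : ℝ) : ℂ))) * Uᴴ := by
      simp only [Matrix.mul_assoc]
    rw [this, hUU, Matrix.mul_one, Matrix.diagonal_mul_diagonal]
    have hz : (fun i => ((max 0 (a i) : ℝ) : ℂ) * ((max 0 (- a i) : ℝ) : ℂ)) = fun _ => 0 := by
      funext i
      rcases le_total 0 (a i) with h | h
      · simp [h]
      · simp [h]
    rw [hz]
    simp
  · exact key _ (fun i => le_max_left _ _)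
  · exact key _ (fun i => le_max_left _ _)

/-- `K = (Hᴴ H)^{1/2}`, the positive semidefinite square root of the Gramian of `H`. -/
noncomputable def gramSqrt {nR nT : ℕ} (H : Matrix (Fin nR) (Fin nT) ℂ) :
    Matrix (Fin nT) (Fin nT) ℂ :=
  CFC.sqrt (Hᴴ * H)

theorem gramSqrt_posSemidef {nR nT : ℕ} (H : Matrix (Fin nR) (Fin nT) ℂ) :
    (gramSqrt H).PosSemidef :=
  Matrix.nonneg_iff_posSemidef.mp (CFC.sqrt_nonneg _)

theorem gramSqrt_mul_self {nR nT : ℕ} (H : Matrix (Fin nR) (Fin nT) ℂ) :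
    gramSqrt H * gramSqrt H = Hᴴ * H :=
  CFC.sqrt_mul_sqrt_self _
    (Matrix.nonneg_iff_posSemidef.mpr (Matrix.posSemidef_conjTranspose_mul_self H))

/-- The mutual information `log det (I + H Q Hᴴ)` of the channel `y = H x + z`,
`z ∼ CN(0, I)`, under the input `x ∼ CN(0, Q)`; the determinant is real and at least `1`
when `Q` is positive semidefinite. -/
noncomputable def mutualInfo {nR nT : ℕ} (H : Matrix (Fin nR) (Fin nT) ℂ)
    (Q : Matrix (Fin nT) (Fin nT) ℂ) : ℝ :=
  Real.log (1 + H * Q * Hᴴ).det.re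

/-- The input covariance matrices obeying the total power constraint and the per-antenna power
constraints. -/
def feasibleCov {nT : ℕ} (Ptot : ℝ) (P : Fin nT → ℝ) : Set (Matrix (Fin nT) (Fin nT) ℂ) :=
  {Q | Q.PosSemidef ∧ Q.trace.re ≤ Ptot ∧ ∀ i, (Q i i).re ≤ P i}

/-- `Q` is a capacity-achieving input covariance matrix: it attains the maximum of the mutual
information over all admissible input covariance matrices. -/
def IsCapacityAchieving {nR nT : ℕ} (H : Matrix (Fin nR) (Fin nT) ℂ) (Ptot : ℝ)
    (P : Fin nT → ℝ) (Q : Matrix (Fin nT) (Fin nT) ℂ) : Prop :=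
  Q ∈ feasibleCov Ptot P ∧ IsMaxOn (mutualInfo H) (feasibleCov Ptot P) Q

/-- `(K Ď K - I)_+` for the diagonal matrix `Ď = diag(d)`. -/
noncomputable def reducedPart {nR nT : ℕ} (H : Matrix (Fin nR) (Fin nT) ℂ) (d : Fin nT → ℝ) :
    Matrix (Fin nT) (Fin nT) ℂ :=
  (gramSqrt H * Matrix.diagonal (fun i => (d i : ℂ)) * gramSqrt H - 1)⁺

/-- `K⁻¹ (K Ď K - I)_+ K⁻¹` for the diagonal matrix `Ď = diag(d)`. -/
noncomputable def reducedCov {nR nT : ℕ} (H : Matrix (Fin nR) (Fin nT) ℂ) (d : Fin nT → ℝ) :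
    Matrix (Fin nT) (Fin nT) ℂ :=
  (gramSqrt H)⁻¹ * reducedPart H d * (gramSqrt H)⁻¹

/-- The objective `-log det [I + (K Ď K - I)_+]` of the reduced problem. -/
noncomputable def reducedObjective {nR nT : ℕ} (H : Matrix (Fin nR) (Fin nT) ℂ)
    (d : Fin nT → ℝ) : ℝ :=
  - Real.log (1 + reducedPart H d).det.re

/-- The constraints of the reduced problem: `Ď = diag(d)` is positive definite, the total power
constraint holds with equality, and the per-antenna power constraints hold. -/
def reducedFeasible {nR nT : ℕ} (H : Matrix (Fin nR) (Fin nT) ℂ) (Ptot : ℝ) (P : Fin nT → ℝ) :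
    Set (Fin nT → ℝ) :=
  {d | (∀ i, 0 < d i) ∧ (reducedCov H d).trace.re = Ptot ∧ ∀ i, (reducedCov H d i i).re ≤ P i}

/-- `d` solves the reduced minimization problem. -/
def IsReducedSolution {nR nT : ℕ} (H : Matrix (Fin nR) (Fin nT) ℂ) (Ptot : ℝ) (P : Fin nT → ℝ)
    (d : Fin nT → ℝ) : Prop :=
  d ∈ reducedFeasible H Ptot P ∧ IsMinOn (reducedObjective H) (reducedFeasible H Ptot P) d

end MIMO

namespace MIMO

open scoped ComplexOrder MatrixOrder Matrix

/-! By Sylvester's identity the mutual information is `f(Q) = log det (I + K Q K)`, which is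
strictly concave for invertible `K`. Compactness gives a maximizer, strict concavity makes it
unique, and monotonicity of `f` in the diagonal entries makes it use all of `Ptot`. The tool
throughout is the tangent inequality `log_det_le_add_trace` with its equality case.

The closed form is Lagrangian duality. All constraints besides `Q ≥ 0` involve only the diagonal, so
for `Ptot > 0` multipliers turn the problem into maximizing `f(Q) - ∑ wᵢ Qᵢᵢ` over `Q ≥ 0`, with all
`wᵢ > 0` (`exists_lagrangian_max`, `lagrangian_weight_pos`). With `dᵢ = 1 / wᵢ`, its only maximizer
is `K⁻¹ (K D K - I)₊ K⁻¹` (`lagrangian_le_posPart`), a water-filling formula. If `Ptot = 0` then `Q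
= 0`, and a small multiple of the identity serves as `D`.

Hence the reduced problem maximizes `f` over a subset of the feasible covariances that contains the
optimum, and uniqueness identifies all its solutions. -/

theorem trace_mul_re_nonneg {n : ℕ} {A B : Matrix (Fin n) (Fin n) ℂ} (hA : A.PosSemidef)
    (hB : B.PosSemidef) : 0 ≤ (A * B).trace.re := by
  have hS : (CFC.sqrt B).PosSemidef := Matrix.nonneg_iff_posSemidef.mp (CFC.sqrt_nonneg _)
  have hSS : CFC.sqrt B * CFC.sqrt B = B :=
    CFC.sqrt_mul_sqrt_self _ (Matrix.nonneg_iff_posSemidef.mpr hB)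
  have h := (hA.conjTranspose_mul_mul_same (CFC.sqrt B)).trace_nonneg
  rw [hS.1.eq, Matrix.mul_assoc, Matrix.trace_mul_comm, Matrix.mul_assoc, hSS] at h
  exact (Complex.nonneg_iff.mp h).1

theorem PosDef.det_re_pos {n : ℕ} {A : Matrix (Fin n) (Fin n) ℂ} (hA : A.PosDef) :
    0 < A.det.re :=
  (Complex.pos_iff.mp hA.det_pos).1

theorem PosDef.ofReal_det_re {n : ℕ} {A : Matrix (Fin n) (Fin n) ℂ} (hA : A.PosDef) :
    ((A.det.re : ℝ) : ℂ) = A.det :=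
  Complex.ext rfl (Complex.pos_iff.mp hA.det_pos).2

/-- Sum `log x ≤ x - 1` over the eigenvalues; strictness away from `x = 1` gives the equality case.
-/
theorem log_det_le_trace_sub {n : ℕ} {C : Matrix (Fin n) (Fin n) ℂ} (hC : C.PosDef) :
    Real.log C.det.re ≤ C.trace.re - n ∧ (Real.log C.det.re = C.trace.re - n → C = 1) := by
  set e := hC.1.eigenvalues with he
  have hpos : ∀ i, 0 < e i := hC.eigenvalues_pos
  have hdet : C.det.re = ∏ i, e i := by
    rw [hC.1.det_eq_prod_eigenvalues]
    norm_cast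
  have htr : C.trace.re - n = ∑ i, (e i - 1) := by
    rw [hC.1.trace_eq_sum_eigenvalues]
    simp [he]
  rw [hdet, htr, Real.log_prod (fun i _ => (hpos i).ne')]
  have hle : ∀ i ∈ Finset.univ, Real.log (e i) ≤ e i - 1 :=
    fun i _ => Real.log_le_sub_one_of_pos (hpos i)
  refine ⟨Finset.sum_le_sum hle, fun h => ?_⟩
  rw [Finset.sum_eq_sum_iff_of_le hle] at h
  have h1 : e = fun _ => 1 := by
    funext i
    by_contra hne
    exact absurd (h i (Finset.mem_univ i)) (Real.log_lt_sub_one_of_pos (hpos i) hne).ne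
  have hs := hC.1.spectral_theorem
  rw [← he, h1] at hs
  rw [hs]
  have : Matrix.diagonal ((RCLike.ofReal : ℝ → ℂ) ∘ fun _ : Fin n => (1 : ℝ)) = 1 := by
    simp [Function.comp_def]
  rw [this, map_one]

/-- The preceding bound applied to `A^{-1/2} B A^{-1/2}`. The equality case is what later yields
strict concavity. -/
theorem log_det_le_add_trace {n : ℕ} {A B : Matrix (Fin n) (Fin n) ℂ} (hA : A.PosDef)
    (hB : B.PosDef) :
    Real.log B.det.re ≤ Real.log A.det.re + (A⁻¹ * (B - A)).trace.re ∧
      (Real.log B.det.re = Real.log A.det.re + (A⁻¹ * (B - A)).trace.re → B = A) := by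
  set S := CFC.sqrt A with hS_def
  have hS : S.PosSemidef := Matrix.nonneg_iff_posSemidef.mp (CFC.sqrt_nonneg _)
  have hSS : S * S = A :=
    CFC.sqrt_mul_sqrt_self _ (Matrix.nonneg_iff_posSemidef.mpr hA.posSemidef)
  have hAu : IsUnit A.det := (Matrix.isUnit_iff_isUnit_det _).mp hA.isUnit
  have hSu : IsUnit S.det := by
    rw [← hSS, Matrix.det_mul] at hAu
    exact isUnit_of_mul_isUnit_left hAu
  have hSi : S⁻¹.IsHermitian := hS.1.inv
  have hC : (S⁻¹ * B * S⁻¹).PosDef := by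
    have := (Matrix.IsUnit.posDef_star_left_conjugate_iff
      ((Matrix.isUnit_nonsing_inv_iff).mpr ((Matrix.isUnit_iff_isUnit_det _).mpr hSu)) (x := B)).mpr hB
    rwa [Matrix.star_eq_conjTranspose, hSi.eq] at this
  have hB' : S * (S⁻¹ * B * S⁻¹) * S = B := by
    simp only [Matrix.mul_assoc, Matrix.nonsing_inv_mul _ hSu, Matrix.mul_one]
    rw [← Matrix.mul_assoc, Matrix.mul_nonsing_inv _ hSu, Matrix.one_mul]
  have hdet : B.det.re = A.det.re * (S⁻¹ * B * S⁻¹).det.re := by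
    have : B.det = A.det * (S⁻¹ * B * S⁻¹).det := by
      conv_lhs => rw [← hB']
      rw [← hSS]
      simp only [Matrix.det_mul]
      ring
    rw [← PosDef.ofReal_det_re hA, ← PosDef.ofReal_det_re hC] at this
    rw [this]
    norm_cast
  have htr : (A⁻¹ * (B - A)).trace.re = (S⁻¹ * B * S⁻¹).trace.re - n := by
    rw [Matrix.mul_sub, Matrix.nonsing_inv_mul _ hAu, Matrix.trace_sub, Matrix.trace_one,
      Matrix.trace_mul_cycle, ← hSS, Matrix.mul_inv_rev]
    simp
  rw [hdet, htr, Real.log_mul (PosDef.det_re_pos hA).ne' (PosDef.det_re_pos hC).ne']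
  obtain ⟨h1, h2⟩ := log_det_le_trace_sub hC
  refine ⟨by linarith, fun h => ?_⟩
  have h3 := h2 (by linarith)
  rw [← hB', h3, Matrix.mul_one, hSS]

/-- Lagrange multipliers for a concave program satisfying Slater's condition. -/
theorem exists_lagrange_multipliers {V ι : Type*} [AddCommGroup V] [Module ℝ V] [Fintype ι]
    {X : Set V} {f : V → ℝ} {g : ι → V → ℝ} (hf : ConcaveOn ℝ X f)
    (hg : ∀ j, ConvexOn ℝ X (g j)) {x₀ : V} (hx₀ : x₀ ∈ X) (hslater : ∀ j, g j x₀ < 0)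
    {m : ℝ} (hm : ∀ x ∈ X, (∀ j, g j x ≤ 0) → f x ≤ m) :
    ∃ l : ι → ℝ, (∀ j, 0 ≤ l j) ∧ ∀ x ∈ X, f x - ∑ j, l j * g j x ≤ m := by
  classical
  -- Pairs of an objective gain and constraint levels that some point of `X` strictly beats. The
  -- bound `m` keeps the origin out, so a hyperplane through the origin separates.
  let A : Set (ℝ × (ι → ℝ)) := ⋃ x ∈ X, Set.Iio (f x - m) ×ˢ Set.univ.pi fun j => Set.Ioi (g j x)
  have hmem : ∀ u : ℝ × (ι → ℝ), u ∈ A ↔ ∃ x ∈ X, u.1 < f x - m ∧ ∀ j, g j x < u.2 j := by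
    intro u
    simp only [A, Set.mem_iUnion, Set.mem_prod, Set.mem_Iio, Set.mem_pi, Set.mem_univ, Set.mem_Ioi,
      true_imp_iff, exists_prop]
  have hopen : IsOpen A :=
    isOpen_biUnion fun x _ =>
      isOpen_Iio.prod (isOpen_set_pi Set.finite_univ fun j _ => isOpen_Ioi)
  have hconv : Convex ℝ A := by
    intro u hu v hv a b ha hb hab
    rw [hmem] at *
    obtain ⟨x, hx, hx1, hx2⟩ := hu
    obtain ⟨y, hy, hy1, hy2⟩ := hv
    have key : ∀ p q r s : ℝ, p < r → q < s → a * p + b * q < a * r + b * s := by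
      intro p q r s h1 h2
      rcases ha.eq_or_lt with h0 | h0
      · have : b = 1 := by linarith
        rw [← h0, this]; linarith
      · have := mul_lt_mul_of_pos_left h1 h0
        have := mul_le_mul_of_nonneg_left h2.le hb
        linarith
    refine ⟨a • x + b • y, hf.1 hx hy ha hb hab, ?_, fun j => ?_⟩
    · have h1 := hf.2 hx hy ha hb hab
      have h2 := key _ _ _ _ hx1 hy1
      simp only [smul_eq_mul, Prod.fst_add, Prod.smul_fst] at *
      have : a * (f x - m) + b * (f y - m) = a * f x + b * f y - (a + b) * m := by ring
      rw [this, hab] at h2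
      linarith
    · have h1 := (hg j).2 hx hy ha hb hab
      have h2 := key _ _ _ _ (hx2 j) (hy2 j)
      simp only [smul_eq_mul, Prod.snd_add, Prod.smul_snd, Pi.add_apply, Pi.smul_apply] at *
      linarith
  have h0 : (0 : ℝ × (ι → ℝ)) ∉ A := by
    rw [hmem]
    rintro ⟨x, hx, h1, h2⟩
    have := hm x hx fun j => (h2 j).le
    simp at h1
    linarith
  obtain ⟨L, hL⟩ := geometric_hahn_banach_open_point hconv hopen h0
  rw [map_zero] at hL
  set c := L (1, 0) with hc
  set r : ι → ℝ := fun j => L (0, Pi.single j 1) with hr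
  have hLe : ∀ t u, L (t, u) = t * c + ∑ j, u j * r j := by
    intro t u
    have : ((t, u) : ℝ × (ι → ℝ)) = t • (1, 0) + ∑ j, u j • (0, Pi.single j 1) := by
      ext i
      · simp [Prod.fst_sum]
      · simp [Prod.snd_sum, Finset.sum_apply, Pi.single_apply]
    rw [this]
    simp only [map_add, map_sum, map_smul, smul_eq_mul, hc, hr]
  have hlt : ∀ x ∈ X, ∀ s > 0, ∀ w : ι → ℝ, (∀ j, 0 < w j) →
      (f x - m - s) * c + ∑ j, (g j x + w j) * r j < 0 := by
    intro x hx s hs w hw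
    rw [← hLe]
    exact hL _ ((hmem _).2 ⟨x, hx, by simpa using hs, fun j => by simpa using hw j⟩)
  have hcpos : 0 < c := by
    -- The choice `w = -g x₀`, allowed by Slater's condition, cancels every constraint term and
    -- isolates `c`.
    have h1 := hlt x₀ hx₀ (|f x₀ - m| + 1) (by positivity) (fun j => - g j x₀)
      (fun j => by simpa using hslater j)
    simp only [add_neg_cancel, zero_mul, Finset.sum_const_zero, add_zero] at h1
    have h2 : f x₀ - m - (|f x₀ - m| + 1) < 0 := by
      have := le_abs_self (f x₀ - m)
      linarith
    by_contra hcon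
    have := mul_nonneg_of_nonpos_of_nonpos h2.le (not_lt.mp hcon)
    linarith
  have hr0 : ∀ j, r j ≤ 0 := by
    intro j
    by_contra hcon
    push Not at hcon
    -- The set is unbounded upwards in coordinate `j`, so a positive coefficient there would break
    -- the bound for large `T`.
    have hdir : ∀ T : ℝ, 0 < T →
        (f x₀ - m - 1) * c + ∑ i, (g i x₀ + (1 : ℝ)) * r i + T * r j < 0 := by
      intro T hT
      have h1 := hlt x₀ hx₀ 1 one_pos (fun i => 1 + if i = j then T else 0)
        (fun i => by positivity)
      have h2 : ∑ i, (g i x₀ + (1 + if i = j then T else 0)) * r i =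
          ∑ i, (g i x₀ + (1 : ℝ)) * r i + T * r j := by
        simp [← add_assoc, add_mul _ (ite _ _ _), Finset.sum_add_distrib]
      rw [h2] at h1
      linarith
    set B := (f x₀ - m - 1) * c + ∑ i, (g i x₀ + (1 : ℝ)) * r i
    have h1 := hdir ((|B| + 1) / r j) (by positivity)
    rw [div_mul_cancel₀ _ hcon.ne'] at h1
    have := neg_abs_le B
    linarith
  refine ⟨fun j => - r j / c, fun j => div_nonneg (by linarith [hr0 j]) hcpos.le, fun x hx => ?_⟩
  have hlim : (f x - m) * c + ∑ j, g j x * r j ≤ 0 := by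
    have hcont : Continuous fun s : ℝ => (f x - m - s) * c + ∑ j, (g j x + s) * r j := by
      fun_prop
    have ht := (hcont.tendsto 0).mono_left (nhdsWithin_le_nhds (s := Set.Ioi 0))
    simp only [sub_zero, add_zero] at ht
    refine le_of_tendsto ht ?_
    filter_upwards [self_mem_nhdsWithin] with s hs
    exact (hlt x hx s hs (fun _ => s) fun _ => hs).le
  have hsum : ∑ j, - r j / c * g j x = - (∑ j, g j x * r j) / c := by
    rw [← Finset.sum_neg_distrib, Finset.sum_div]
    refine Finset.sum_congr rfl fun j _ => ?_
    ring
  rw [hsum, sub_le_iff_le_add, ← sub_le_iff_le_add', le_div_iff₀ hcpos]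
  linarith

/-! ### Concavity and monotonicity of `log det (I + K Q K)` -/

/-- The concave function `Q ↦ log det (I + K Q K)`. -/
noncomputable def logDetCongr {n : ℕ} (K Q : Matrix (Fin n) (Fin n) ℂ) : ℝ :=
  Real.log (1 + K * Q * K).det.re

/-- The gradient `K (I + K Q K)⁻¹ K` of `logDetCongr K` at `Q`. -/
noncomputable def logDetCongrGrad {n : ℕ} (K Q : Matrix (Fin n) (Fin n) ℂ) :
    Matrix (Fin n) (Fin n) ℂ :=
  K * (1 + K * Q * K)⁻¹ * K

section Fin
variable {n : ℕ} {K Q Q₀ : Matrix (Fin n) (Fin n) ℂ}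

theorem posDef_one_add_congr (hK : K.PosDef) (hQ : Q.PosSemidef) : (1 + K * Q * K).PosDef := by
  refine Matrix.PosDef.one.add_posSemidef ?_
  have := hQ.conjTranspose_mul_mul_same K
  rwa [hK.1.eq] at this

theorem posDef_logDetCongrGrad (hK : K.PosDef) (hQ : Q.PosSemidef) :
    (logDetCongrGrad K Q).PosDef := by
  have := (Matrix.IsUnit.posDef_star_left_conjugate_iff hK.isUnit).mpr
    (posDef_one_add_congr hK hQ).inv
  rwa [Matrix.star_eq_conjTranspose, hK.1.eq] at this

theorem isUnit_det_of_posDef (hK : K.PosDef) : IsUnit K.det :=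
  (Matrix.isUnit_iff_isUnit_det _).mp hK.isUnit

theorem congr_injective (hK : K.PosDef) (h : K * Q * K = K * Q₀ * K) : Q = Q₀ :=
  hK.isUnit.mul_left_cancel (hK.isUnit.mul_right_cancel h)

theorem logDetCongr_le_add_trace (hK : K.PosDef) (hQ : Q.PosSemidef) (hQ₀ : Q₀.PosSemidef) :
    logDetCongr K Q ≤ logDetCongr K Q₀ + (logDetCongrGrad K Q₀ * (Q - Q₀)).trace.re ∧
      (logDetCongr K Q = logDetCongr K Q₀ + (logDetCongrGrad K Q₀ * (Q - Q₀)).trace.re →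
        Q = Q₀) := by
  have h := log_det_le_add_trace (posDef_one_add_congr hK hQ₀) (posDef_one_add_congr hK hQ)
  have htr : ((1 + K * Q₀ * K)⁻¹ * (1 + K * Q * K - (1 + K * Q₀ * K))).trace =
      (logDetCongrGrad K Q₀ * (Q - Q₀)).trace := by
    have : 1 + K * Q * K - (1 + K * Q₀ * K) = K * (Q - Q₀) * K := by
      rw [Matrix.mul_sub, Matrix.sub_mul]
      abel
    rw [this, logDetCongrGrad, ← Matrix.mul_assoc, Matrix.trace_mul_comm]
    simp only [Matrix.mul_assoc]
  rw [htr] at h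
  exact ⟨h.1, fun he => congr_injective hK (add_left_cancel (h.2 he))⟩

theorem convex_posSemidef : Convex ℝ {Q : Matrix (Fin n) (Fin n) ℂ | Q.PosSemidef} :=
  fun _ hA _ hB _ _ ha hb _ => (Matrix.PosSemidef.smul hA ha).add (Matrix.PosSemidef.smul hB hb)

/-- Average the tangent inequalities at the convex combination `M`; the linear terms cancel. -/
theorem concaveOn_logDetCongr (hK : K.PosDef) :
    ConcaveOn ℝ {Q : Matrix (Fin n) (Fin n) ℂ | Q.PosSemidef} (logDetCongr K) := by
  refine ⟨convex_posSemidef, fun A hA B hB a b ha hb hab => ?_⟩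
  have hM := convex_posSemidef hA hB ha hb hab
  set M := a • A + b • B with hM_def
  have h1 := mul_le_mul_of_nonneg_left (logDetCongr_le_add_trace hK hA hM).1 ha
  have h2 := mul_le_mul_of_nonneg_left (logDetCongr_le_add_trace hK hB hM).1 hb
  set G := logDetCongrGrad K M
  have h3 : a * (G * (A - M)).trace.re + b * (G * (B - M)).trace.re = 0 := by
    have : a • (G * (A - M)) + b • (G * (B - M)) = 0 := by
      rw [← Matrix.mul_smul, ← Matrix.mul_smul, ← Matrix.mul_add]
      have : a • (A - M) + b • (B - M) = M - (a + b) • M := by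
        rw [hM_def]; module
      rw [this, hab, one_smul, sub_self, Matrix.mul_zero]
    have h4 := congrArg (fun Z => (Matrix.trace Z).re) this
    simpa [Matrix.trace_add, Matrix.trace_smul] using h4
  have h5 : a * logDetCongr K M + b * logDetCongr K M = logDetCongr K M := by
    rw [← add_mul, hab, one_mul]
  simp only [smul_eq_mul]
  linarith

/-- The tangent inequality is taken at the larger matrix, where the gradient is positive definite
and so has a positive diagonal. -/
theorem logDetCongr_lt_add_diagonal (hK : K.PosDef) (hQ : Q.PosSemidef) (i : Fin n) {t : ℝ}
    (ht : 0 < t) :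
    (Q + Matrix.diagonal (Pi.single i (t : ℂ))).PosSemidef ∧
      logDetCongr K Q < logDetCongr K (Q + Matrix.diagonal (Pi.single i (t : ℂ))) := by
  have hD : (Matrix.diagonal (Pi.single i (t : ℂ))).PosSemidef := by
    refine Matrix.PosSemidef.diagonal ?_
    rw [Pi.single_nonneg]
    exact_mod_cast ht.le
  have hQ' := hQ.add hD
  refine ⟨hQ', ?_⟩
  have h := (logDetCongr_le_add_trace hK hQ hQ').1
  have hG := (Complex.pos_iff.mp ((posDef_logDetCongrGrad hK hQ').diag_pos (i := i))).1
  have htr : (logDetCongrGrad K (Q + Matrix.diagonal (Pi.single i (t : ℂ))) *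
      (Q - (Q + Matrix.diagonal (Pi.single i (t : ℂ))))).trace.re =
      - ((logDetCongrGrad K (Q + Matrix.diagonal (Pi.single i (t : ℂ)))) i i).re * t := by
    rw [sub_add_cancel_left, Matrix.mul_neg, Matrix.trace_neg, Matrix.trace]
    simp [Matrix.mul_diagonal, Pi.single_apply]
  rw [htr] at h
  nlinarith

/-! ### Existence, uniqueness and full power of the maximizer -/

theorem isClosed_posSemidef : IsClosed {Q : Matrix (Fin n) (Fin n) ℂ | Q.PosSemidef} := by
  have : {Q : Matrix (Fin n) (Fin n) ℂ | Q.PosSemidef} =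
      {Q | Qᴴ = Q} ∩ ⋂ x : Fin n → ℂ, {Q | 0 ≤ star x ⬝ᵥ (Q *ᵥ x)} := by
    ext Q
    simp [Matrix.posSemidef_iff_dotProduct_mulVec, Matrix.IsHermitian]
  rw [this]
  refine (isClosed_eq (by fun_prop) continuous_id).inter (isClosed_iInter fun x => ?_)
  exact isClosed_le continuous_const (by fun_prop)

/-- The 2×2 principal minor gives `|Qᵢⱼ|² ≤ Qᵢᵢ Qⱼⱼ`. This bounds the feasible set. -/
theorem norm_apply_le_trace (hQ : Q.PosSemidef) (i j : Fin n) : ‖Q i j‖ ≤ Q.trace.re := by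
  have hd : ∀ k, 0 ≤ (Q k k).re := fun k => (Complex.nonneg_iff.mp hQ.diag_nonneg).1
  have hdi : ∀ k, (Q k k).im = 0 := fun k => (Complex.nonneg_iff.mp hQ.diag_nonneg).2.symm
  have htr : Q.trace.re = ∑ k, (Q k k).re := by simp [Matrix.trace]
  have hle : ∀ k, (Q k k).re ≤ Q.trace.re := fun k => by
    rw [htr]
    exact Finset.single_le_sum (f := fun k => (Q k k).re) (fun k _ => hd k) (Finset.mem_univ k)
  have hdet := (Complex.nonneg_iff.mp (hQ.submatrix ![i, j]).det_nonneg).1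
  rw [Matrix.det_fin_two] at hdet
  have hji : Q j i = star (Q i j) := (hQ.1.apply j i).symm
  simp only [Matrix.submatrix_apply, Matrix.cons_val_zero, Matrix.cons_val_one, hji,
    Complex.star_def, Complex.mul_conj, Complex.sub_re, Complex.mul_re, hdi, Complex.ofReal_re,
    Complex.normSq_eq_norm_sq, mul_zero, sub_zero] at hdet
  have h1 := mul_le_mul (hle i) (hle j) (hd j) ((hd i).trans (hle i))
  exact le_of_sq_le_sq (by nlinarith) ((hd i).trans (hle i))

theorem isCompact_feasibleCov (Ptot : ℝ) (P : Fin n → ℝ) : IsCompact (feasibleCov Ptot P) := by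
  have hbox : IsCompact {Q : Matrix (Fin n) (Fin n) ℂ |
      ∀ i ∈ Set.univ, Q i ∈ Set.univ.pi fun _ => Metric.closedBall (0 : ℂ) Ptot} :=
    isCompact_univ_pi fun _ => isCompact_univ_pi fun _ => isCompact_closedBall _ _
  refine hbox.of_isClosed_subset ?_ ?_
  · refine isClosed_posSemidef.inter (IsClosed.inter ?_ ?_)
    · exact isClosed_le (Complex.continuous_re.comp (by fun_prop)) continuous_const
    · change IsClosed {Q : Matrix (Fin n) (Fin n) ℂ | ∀ i, (Q i i).re ≤ P i}
      simp only [Set.ofPred_forall]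
      exact isClosed_iInter fun i => isClosed_le (by fun_prop) continuous_const
  · intro Q hQ i _ j _
    rw [mem_closedBall_zero_iff]
    exact (norm_apply_le_trace hQ.1 i j).trans hQ.2.1

theorem continuousOn_logDetCongr (hK : K.PosDef) :
    ContinuousOn (logDetCongr K) {Q : Matrix (Fin n) (Fin n) ℂ | Q.PosSemidef} := by
  refine ContinuousOn.log ?_ fun Q hQ => (PosDef.det_re_pos (posDef_one_add_congr hK hQ)).ne'
  exact (Complex.continuous_re.comp (by fun_prop)).continuousOn

theorem convex_feasibleCov (Ptot : ℝ) (P : Fin n → ℝ) : Convex ℝ (feasibleCov Ptot P) := by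
  intro A hA B hB a b ha hb hab
  refine ⟨convex_posSemidef hA.1 hB.1 ha hb hab, ?_, fun i => ?_⟩
  · have h1 := mul_le_mul_of_nonneg_left hA.2.1 ha
    have h2 := mul_le_mul_of_nonneg_left hB.2.1 hb
    have : a * Ptot + b * Ptot = Ptot := by rw [← add_mul, hab, one_mul]
    simp [Matrix.trace_add, Matrix.trace_smul]
    linarith
  · have h1 := mul_le_mul_of_nonneg_left (hA.2.2 i) ha
    have h2 := mul_le_mul_of_nonneg_left (hB.2.2 i) hb
    have : a * P i + b * P i = P i := by rw [← add_mul, hab, one_mul]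
    simp
    linarith

/-- The tangent inequalities at the midpoint have opposite linear terms, so both must be equalities.
-/
theorem isMaxOn_logDetCongr_unique (hK : K.PosDef) {S : Set (Matrix (Fin n) (Fin n) ℂ)}
    (hS : Convex ℝ S) (hpos : ∀ Q ∈ S, Q.PosSemidef) (hQ : Q ∈ S)
    (hmax : IsMaxOn (logDetCongr K) S Q) (hQ₀ : Q₀ ∈ S) (hmax₀ : IsMaxOn (logDetCongr K) S Q₀) :
    Q = Q₀ := by
  have hM : (1 / 2 : ℝ) • Q + (1 / 2 : ℝ) • Q₀ ∈ S :=
    hS hQ hQ₀ (by norm_num) (by norm_num) (by norm_num)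
  set M := (1 / 2 : ℝ) • Q + (1 / 2 : ℝ) • Q₀ with hM_def
  have h1 := logDetCongr_le_add_trace hK (hpos _ hQ) (hpos _ hM)
  have h2 := logDetCongr_le_add_trace hK (hpos _ hQ₀) (hpos _ hM)
  have h3 : logDetCongr K M ≤ logDetCongr K Q := hmax hM
  have h4 : logDetCongr K M ≤ logDetCongr K Q₀ := hmax₀ hM
  have h5 : Q - M = -(Q₀ - M) := by rw [hM_def]; module
  rw [h5, Matrix.mul_neg, Matrix.trace_neg, Complex.neg_re] at h1
  have e1 := h1.2 (by linarith [h1.1, h2.1])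
  have e2 := h2.2 (by linarith [h1.1, h2.1])
  rw [e1, ← e2]

/-- Unused total power leaves some antenna below its limit, because `Ptot ≤ ∑ Pᵢ`; raising that
diagonal entry improves the objective. -/
theorem trace_eq_of_isMaxOn (hK : K.PosDef) {Ptot : ℝ} {P : Fin n → ℝ} (hsum : Ptot ≤ ∑ i, P i)
    (hQ : Q ∈ feasibleCov Ptot P) (hmax : IsMaxOn (logDetCongr K) (feasibleCov Ptot P) Q) :
    Q.trace.re = Ptot := by
  refine le_antisymm hQ.2.1 (not_lt.mp fun hlt => ?_)
  have htr : Q.trace.re = ∑ k, (Q k k).re := by simp [Matrix.trace]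
  obtain ⟨i, -, hi⟩ := Finset.exists_lt_of_sum_lt (htr ▸ hlt.trans_le hsum)
  have ht : 0 < min (Ptot - Q.trace.re) (P i - (Q i i).re) :=
    lt_min (by linarith) (by linarith)
  obtain ⟨h1, h2⟩ := logDetCongr_lt_add_diagonal hK hQ.1 i ht
  refine absurd (hmax (a := _) ⟨h1, ?_, fun j => ?_⟩) (not_le.mpr h2)
  · have := min_le_left (Ptot - Q.trace.re) (P i - (Q i i).re)
    rw [Matrix.trace_add, Matrix.trace_diagonal, Finset.sum_pi_single', Complex.add_re]
    simp only [Finset.mem_univ, if_true, Complex.ofReal_re]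
    linarith
  · have := min_le_right (Ptot - Q.trace.re) (P i - (Q i i).re)
    rcases eq_or_ne j i with rfl | hj
    · rw [Matrix.add_apply, Matrix.diagonal_apply_eq, Pi.single_eq_same, Complex.add_re,
        Complex.ofReal_re]
      linarith
    · simpa [hj] using hQ.2.2 j

/-! ### The Lagrangian maximizer in closed form -/

theorem posDef_congr_diagonal (hK : K.PosDef) {d : Fin n → ℝ} (hd : ∀ i, 0 < d i) :
    (K * Matrix.diagonal (fun i => (d i : ℂ)) * K).PosDef := by
  have hD : (Matrix.diagonal (fun i => (d i : ℂ))).PosDef :=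
    Matrix.PosDef.diagonal fun i => by exact_mod_cast hd i
  have := (Matrix.IsUnit.posDef_star_left_conjugate_iff hK.isUnit).mpr hD
  rwa [Matrix.star_eq_conjTranspose, hK.1.eq] at this

theorem congr_inv_congr (hK : K.PosDef) (X : Matrix (Fin n) (Fin n) ℂ) :
    K * (K⁻¹ * X * K⁻¹) * K = X := by
  have hKu := isUnit_det_of_posDef hK
  simp only [Matrix.mul_assoc, Matrix.nonsing_inv_mul _ hKu, Matrix.mul_one]
  rw [← Matrix.mul_assoc, Matrix.mul_nonsing_inv _ hKu, Matrix.one_mul]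

/-- The positive part `(E - I)₊` satisfies the optimality conditions of the Lagrangian with
multiplier `E⁻¹`. -/
theorem inv_sub_inv_one_add_posPart {E : Matrix (Fin n) (Fin n) ℂ} (hE : E.PosDef) :
    (E⁻¹ - (1 + (E - 1)⁺)⁻¹).PosSemidef ∧ (E⁻¹ - (1 + (E - 1)⁺)⁻¹) * (E - 1)⁺ = 0 := by
  have hsa : IsSelfAdjoint (E - 1) := hE.1.sub Matrix.isHermitian_one
  have hX : 0 ≤ (E - 1)⁺ := CFC.posPart_nonneg _
  have hY : 0 ≤ (E - 1)⁻ := CFC.negPart_nonneg _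
  have hXY : (E - 1)⁺ * (E - 1)⁻ = 0 := CFC.posPart_mul_negPart _
  have hYX : (E - 1)⁻ * (E - 1)⁺ = 0 := CFC.negPart_mul_posPart _
  have hsub : (E - 1)⁺ - (E - 1)⁻ = E - 1 := CFC.posPart_sub_negPart _ hsa
  set X := (E - 1)⁺
  set Y := (E - 1)⁻
  have hE' : E = 1 + X - Y := by rw [add_sub_assoc, hsub]; abel
  have hA : (1 + X).PosDef :=
    Matrix.PosDef.one.add_posSemidef (Matrix.nonneg_iff_posSemidef.mp hX)
  have hEu := isUnit_det_of_posDef hE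
  have hAu := isUnit_det_of_posDef hA
  have hYA : Y * (1 + X)⁻¹ = Y := by
    have : Y * (1 + X) = Y := by rw [Matrix.mul_add, hYX, Matrix.mul_one, add_zero]
    conv_lhs => rw [← this]
    rw [Matrix.mul_assoc, Matrix.mul_nonsing_inv _ hAu, Matrix.mul_one]
  -- Resolvent identity with `1 + X - E = Y`. As `E` and `Y` commute, the product is positive
  -- semidefinite, and `Y X = 0` gives complementary slackness.
  have hN : E⁻¹ - (1 + X)⁻¹ = E⁻¹ * Y := by
    have h1 : E⁻¹ * (1 + X - E) * (1 + X)⁻¹ = E⁻¹ - (1 + X)⁻¹ := by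
      rw [Matrix.mul_sub, Matrix.sub_mul, Matrix.mul_assoc, Matrix.mul_nonsing_inv _ hAu,
        Matrix.mul_one, Matrix.nonsing_inv_mul _ hEu, Matrix.one_mul]
    have h2 : 1 + X - E = Y := by rw [hE']; abel
    rw [← h1, h2, Matrix.mul_assoc, hYA]
  have hcomm : Commute E Y := by
    rw [Commute, SemiconjBy, hE']
    simp only [Matrix.sub_mul, Matrix.mul_sub, Matrix.add_mul, Matrix.mul_add, hXY, hYX,
      Matrix.one_mul, Matrix.mul_one]
  have hcomm' : Commute E⁻¹ Y := by
    have h : Y = E * Y * E⁻¹ := by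
      rw [hcomm.eq, Matrix.mul_assoc, Matrix.mul_nonsing_inv _ hEu, Matrix.mul_one]
    rw [Commute, SemiconjBy]
    conv_lhs => rw [h]
    rw [Matrix.mul_assoc, ← Matrix.mul_assoc, Matrix.nonsing_inv_mul _ hEu, Matrix.one_mul]
  rw [hN]
  refine ⟨Matrix.nonneg_iff_posSemidef.mp ?_, by rw [Matrix.mul_assoc, hYX, Matrix.mul_zero]⟩
  exact hcomm'.mul_nonneg (Matrix.nonneg_iff_posSemidef.mpr hE.inv.posSemidef) hY

/-- The KKT conditions suffice: the gradient at `Q₀` is `D⁻¹ - K N K` with `N ≥ 0` and `N (K Q₀ K) =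
0`, so in the tangent inequality the `N` term only lowers the bound. -/
theorem lagrangian_le_posPart (hK : K.PosDef) {d : Fin n → ℝ} (hd : ∀ i, 0 < d i)
    (hQ : Q.PosSemidef)
    (hQ₀ : Q₀ = K⁻¹ * (K * Matrix.diagonal (fun i => (d i : ℂ)) * K - 1)⁺ * K⁻¹) :
    logDetCongr K Q - ∑ i, (d i)⁻¹ * (Q i i).re ≤
        logDetCongr K Q₀ - ∑ i, (d i)⁻¹ * (Q₀ i i).re ∧
      (logDetCongr K Q - ∑ i, (d i)⁻¹ * (Q i i).re =
        logDetCongr K Q₀ - ∑ i, (d i)⁻¹ * (Q₀ i i).re → Q = Q₀) := by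
  have hKu := isUnit_det_of_posDef hK
  obtain ⟨hN, hNX⟩ := inv_sub_inv_one_add_posPart (posDef_congr_diagonal hK hd)
  set E := K * Matrix.diagonal (fun i => (d i : ℂ)) * K with hE
  have hX : ((E - 1)⁺).PosSemidef := Matrix.nonneg_iff_posSemidef.mp (CFC.posPart_nonneg _)
  set X := (E - 1)⁺
  have hKQ₀ : K * Q₀ * K = X := by rw [hQ₀, congr_inv_congr hK]
  have hQ₀p : Q₀.PosSemidef := by
    have := hX.conjTranspose_mul_mul_same K⁻¹
    rwa [hK.inv.1.eq, ← hQ₀] at this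
  have hEinv : K * E⁻¹ * K = Matrix.diagonal (fun i => ((d i)⁻¹ : ℂ)) := by
    have hDinv : (Matrix.diagonal (fun i => (d i : ℂ)))⁻¹ =
        Matrix.diagonal (fun i => ((d i)⁻¹ : ℂ)) := by
      refine Matrix.inv_eq_right_inv ?_
      rw [Matrix.diagonal_mul_diagonal, ← Matrix.diagonal_one]
      congr 1
      funext i
      exact mul_inv_cancel₀ (by exact_mod_cast (hd i).ne')
    rw [hE, Matrix.mul_inv_rev, Matrix.mul_inv_rev, hDinv]
    simp only [Matrix.mul_assoc, Matrix.nonsing_inv_mul _ hKu, Matrix.mul_one]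
    rw [← Matrix.mul_assoc, Matrix.mul_nonsing_inv _ hKu, Matrix.one_mul]
  have hG : logDetCongrGrad K Q₀ =
      Matrix.diagonal (fun i => ((d i)⁻¹ : ℂ)) - K * (E⁻¹ - (1 + X)⁻¹) * K := by
    rw [logDetCongrGrad, hKQ₀, Matrix.mul_sub, Matrix.sub_mul, hEinv]
    abel
  have htr : ∀ R : Matrix (Fin n) (Fin n) ℂ,
      (Matrix.diagonal (fun i => ((d i)⁻¹ : ℂ)) * R).trace.re = ∑ i, (d i)⁻¹ * (R i i).re := by
    intro R
    rw [Matrix.trace, Complex.re_sum]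
    refine Finset.sum_congr rfl fun i _ => ?_
    rw [Matrix.diag_apply, Matrix.diagonal_mul, ← Complex.ofReal_inv, Complex.re_ofReal_mul]
  have hcyc : ∀ R : Matrix (Fin n) (Fin n) ℂ, (K * (E⁻¹ - (1 + X)⁻¹) * K * R).trace =
      ((E⁻¹ - (1 + X)⁻¹) * (K * R * K)).trace := by
    intro R
    rw [Matrix.mul_assoc, Matrix.mul_assoc, Matrix.trace_mul_comm]
    simp only [Matrix.mul_assoc]
  have hslack : (K * (E⁻¹ - (1 + X)⁻¹) * K * Q₀).trace = 0 := by
    rw [hcyc, hKQ₀, hNX, Matrix.trace_zero]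
  have hnonneg : 0 ≤ (K * (E⁻¹ - (1 + X)⁻¹) * K * Q).trace.re := by
    rw [hcyc]
    refine trace_mul_re_nonneg hN ?_
    have := hQ.conjTranspose_mul_mul_same K
    rwa [hK.1.eq] at this
  have hmain := logDetCongr_le_add_trace hK hQ hQ₀p
  have hexp : (logDetCongrGrad K Q₀ * (Q - Q₀)).trace.re =
      ∑ i, (d i)⁻¹ * (Q i i).re - ∑ i, (d i)⁻¹ * (Q₀ i i).re -
        (K * (E⁻¹ - (1 + X)⁻¹) * K * Q).trace.re := by
    rw [hG, Matrix.mul_sub, Matrix.sub_mul, Matrix.sub_mul, Matrix.trace_sub, Matrix.trace_sub,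
      Matrix.trace_sub, hslack, ← htr, ← htr]
    simp only [Complex.sub_re, Complex.zero_re]
    ring
  rw [hexp] at hmain
  exact ⟨by linarith [hmain.1], fun h => hmain.2 (by linarith [hmain.1])⟩

end Fin

/-! ### From the channel matrix to its Gram square root -/

theorem posDef_gramSqrt {nR nT : ℕ} {H : Matrix (Fin nR) (Fin nT) ℂ} (hH : H.rank = nT) :
    (gramSqrt H).PosDef := by
  refine (gramSqrt_posSemidef H).posDef_iff_isUnit.mpr ?_
  have hrank : nT ≤ (gramSqrt H).rank := by
    calc nT = (gramSqrt H * gramSqrt H).rank := by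
          rw [gramSqrt_mul_self, Matrix.rank_conjTranspose_mul_self, hH]
      _ ≤ (gramSqrt H).rank := Matrix.rank_mul_le_left _ _
  rw [← Matrix.mulVec_surjective_iff_isUnit]
  have htop : LinearMap.range (gramSqrt H).mulVecLin = ⊤ := by
    refine Submodule.eq_top_of_finrank_eq (le_antisymm (Submodule.finrank_le _) ?_)
    simpa [Matrix.rank] using hrank
  exact LinearMap.range_eq_top.mp htop

theorem mutualInfo_eq_logDetCongr {nR nT : ℕ} (H : Matrix (Fin nR) (Fin nT) ℂ)
    (Q : Matrix (Fin nT) (Fin nT) ℂ) : mutualInfo H Q = logDetCongr (gramSqrt H) Q := by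
  have h : (1 + H * Q * Hᴴ).det = (1 + gramSqrt H * Q * gramSqrt H).det := by
    rw [Matrix.mul_assoc, Matrix.det_one_add_mul_comm, Matrix.mul_assoc, ← gramSqrt_mul_self,
      ← Matrix.mul_assoc, Matrix.det_one_add_mul_comm, Matrix.mul_assoc]
  rw [mutualInfo, logDetCongr, h]

/-! ### Multipliers for the power constraints -/

section Fin
variable {n : ℕ} {K Q : Matrix (Fin n) (Fin n) ℂ}

theorem exists_lagrangian_max (hK : K.PosDef) {Ptot : ℝ} {P : Fin n → ℝ} (hPtot : 0 < Ptot)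
    (hP : ∀ i, 0 < P i) (hsum : Ptot ≤ ∑ i, P i) (hQ : Q ∈ feasibleCov Ptot P)
    (hmax : IsMaxOn (logDetCongr K) (feasibleCov Ptot P) Q) :
    ∃ w : Fin n → ℝ, ∀ R : Matrix (Fin n) (Fin n) ℂ, R.PosSemidef →
      logDetCongr K R - ∑ i, w i * (R i i).re ≤ logDetCongr K Q - ∑ i, w i * (Q i i).re := by
  have hS : 0 < ∑ i, P i := hPtot.trans_le hsum
  -- The Slater point `s • diag(P)` has trace `Ptot / 2` and, as `s < 1`, entries strictly below the
  -- antenna limits.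
  set s := Ptot / (2 * ∑ i, P i) with hs_def
  have hs : 0 < s := by positivity
  have hs1 : s < 1 := by
    rw [hs_def, div_lt_one (by positivity)]
    linarith
  have hsP : s * ∑ i, P i = Ptot / 2 := by
    rw [hs_def]
    field_simp
  have htr : ∀ R : Matrix (Fin n) (Fin n) ℂ, R.trace.re = ∑ i, (R i i).re := fun R => by
    simp [Matrix.trace]
  let g : Option (Fin n) → Matrix (Fin n) (Fin n) ℂ → ℝ := fun j R =>
    j.elim (R.trace.re - Ptot) fun i => (R i i).re - P i
  have hg : ∀ j, ConvexOn ℝ {R : Matrix (Fin n) (Fin n) ℂ | R.PosSemidef} (g j) := by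
    intro j
    refine ⟨convex_posSemidef, fun A _ B _ a b _ _ hab => le_of_eq ?_⟩
    obtain rfl : b = 1 - a := by linarith
    cases j
    · simp [g, Matrix.trace_add, Matrix.trace_smul]
      ring
    · simp [g]
      ring
  obtain ⟨l, hl, hlag⟩ := exists_lagrange_multipliers (concaveOn_logDetCongr hK) hg
    (x₀ := Matrix.diagonal fun i => ((s * P i : ℝ) : ℂ)) (m := logDetCongr K Q)
    (Matrix.PosSemidef.diagonal fun i => by
      simpa only [Pi.zero_apply, Complex.zero_le_real] using (mul_pos hs (hP i)).le)
    (by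
      intro j
      cases j with
      | none =>
        simp only [g, Option.elim, htr, Matrix.diagonal_apply_eq, Complex.ofReal_re,
          ← Finset.mul_sum, hsP]
        linarith
      | some i =>
        simp only [g, Option.elim, Matrix.diagonal_apply_eq, Complex.ofReal_re]
        nlinarith [hP i])
    (fun R hR hgR => hmax (a := R) ⟨hR, by simpa [g] using hgR none,
      fun i => by simpa [g] using hgR (some i)⟩)
  have hsplit : ∀ R : Matrix (Fin n) (Fin n) ℂ, ∑ j, l j * g j R =
      ∑ i, (l none + l (some i)) * (R i i).re - (l none * Ptot + ∑ i, l (some i) * P i) := by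
    intro R
    simp only [Fintype.sum_option, g, Option.elim, htr, add_mul, mul_sub, Finset.sum_add_distrib,
      Finset.sum_sub_distrib, Finset.mul_sum]
    ring
  have hQg : ∑ j, l j * g j Q ≤ 0 := by
    refine Finset.sum_nonpos fun j _ => mul_nonpos_of_nonneg_of_nonpos (hl j) ?_
    cases j with
    | none => simpa [g] using hQ.2.1
    | some i => simpa [g] using hQ.2.2 i
  -- The total-power multiplier is added to each antenna's own. No complementary slackness is
  -- needed: `∑ l g ≤ 0` at `Q`, and the constants cancel.
  refine ⟨fun i => l none + l (some i), fun R hR => ?_⟩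
  have h := hlag R hR
  rw [hsplit] at h hQg
  linarith

theorem lagrangian_weight_pos (hK : K.PosDef) (hQ : Q.PosSemidef) {w : Fin n → ℝ}
    (hw : ∀ R : Matrix (Fin n) (Fin n) ℂ, R.PosSemidef →
      logDetCongr K R - ∑ i, w i * (R i i).re ≤ logDetCongr K Q - ∑ i, w i * (Q i i).re)
    (i : Fin n) : 0 < w i := by
  obtain ⟨h1, h2⟩ := logDetCongr_lt_add_diagonal hK hQ i one_pos
  have h := hw _ h1
  have hexp : ∑ j, w j * ((Q + Matrix.diagonal (Pi.single i ((1 : ℝ) : ℂ))) j j).re =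
      ∑ j, w j * (Q j j).re + w i := by
    simp [Pi.single_apply, mul_add, Finset.sum_add_distrib, apply_ite Complex.re]
  rw [hexp] at h
  linarith

open scoped Matrix.Norms.L2Operator in
-- This serves `Ptot = 0`, where the positive part must vanish while every `dᵢ` stays positive.
theorem exists_pos_congr_diagonal_le_one (hK : K.PosDef) :
    ∃ c : ℝ, 0 < c ∧ K * Matrix.diagonal (fun _ => (c : ℂ)) * K ≤ 1 := by
  have hsa : IsSelfAdjoint (K * K) := by
    rw [isSelfAdjoint_iff, Matrix.star_eq_conjTranspose, Matrix.conjTranspose_mul, hK.1.eq]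
  have hle := hsa.le_algebraMap_norm_self
  set r := ‖K * K‖
  have hr : 0 ≤ r := norm_nonneg _
  refine ⟨(r + 1)⁻¹, by positivity, ?_⟩
  have hc : K * Matrix.diagonal (fun _ => (((r + 1)⁻¹ : ℝ) : ℂ)) * K = (r + 1)⁻¹ • (K * K) := by
    have : Matrix.diagonal (fun _ : Fin n => (((r + 1)⁻¹ : ℝ) : ℂ)) =
        (r + 1)⁻¹ • (1 : Matrix (Fin n) (Fin n) ℂ) := by
      ext i j
      simp [Matrix.diagonal_apply, Matrix.one_apply]
    rw [this, Matrix.mul_smul, Matrix.smul_mul, Matrix.mul_one]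
  rw [hc]
  have h1 : ((r + 1)⁻¹ • (algebraMap ℝ (Matrix (Fin n) (Fin n) ℂ) r - K * K)).PosSemidef :=
    Matrix.PosSemidef.smul (Matrix.le_iff.mp hle) (by positivity)
  have h2 : ((r + 1)⁻¹ • (1 : Matrix (Fin n) (Fin n) ℂ)).PosSemidef :=
    Matrix.PosSemidef.smul Matrix.PosSemidef.one (by positivity)
  have h3 := h1.add h2
  rw [Matrix.le_iff]
  refine (congrArg Matrix.PosSemidef ?_).mp h3
  rw [Algebra.algebraMap_eq_smul_one, smul_sub, smul_smul, sub_add_eq_add_sub, ← add_smul]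
  have : (r + 1)⁻¹ * r + (r + 1)⁻¹ = 1 := by field_simp
  rw [this, one_smul]

theorem exists_diagonal_of_isMaxOn (hK : K.PosDef) {Ptot : ℝ} {P : Fin n → ℝ} (hPtot : 0 ≤ Ptot)
    (hP : ∀ i, 0 < P i) (hsum : Ptot ≤ ∑ i, P i) (hQ : Q ∈ feasibleCov Ptot P)
    (hmax : IsMaxOn (logDetCongr K) (feasibleCov Ptot P) Q) :
    ∃ d : Fin n → ℝ, (∀ i, 0 < d i) ∧
      Q = K⁻¹ * (K * Matrix.diagonal (fun i => (d i : ℂ)) * K - 1)⁺ * K⁻¹ := by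
  -- Slater's condition fails at `Ptot = 0`, since no positive semidefinite matrix has negative
  -- trace.
  rcases hPtot.eq_or_lt with h0 | hpos
  · obtain ⟨c, hc, hle⟩ := exists_pos_congr_diagonal_le_one hK
    have htr : Q.trace = 0 :=
      Complex.ext ((trace_eq_of_isMaxOn hK hsum hQ hmax).trans h0.symm)
        (Complex.nonneg_iff.mp hQ.1.trace_nonneg).2.symm
    have hsa : IsSelfAdjoint (K * Matrix.diagonal (fun _ => (c : ℂ)) * K - 1) :=
      (posDef_congr_diagonal hK (d := fun _ => c) fun _ => hc).1.sub Matrix.isHermitian_one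
    refine ⟨fun _ => c, fun _ => hc, ?_⟩
    rw [(CFC.posPart_eq_zero_iff _ hsa).mpr (sub_nonpos.mpr hle), Matrix.mul_zero,
      Matrix.zero_mul]
    exact hQ.1.trace_eq_zero_iff.mp htr
  · obtain ⟨w, hw⟩ := exists_lagrangian_max hK hpos hP hsum hQ hmax
    have hwpos := lagrangian_weight_pos hK hQ.1 hw
    have hd : ∀ i, 0 < (w i)⁻¹ := fun i => inv_pos.mpr (hwpos i)
    refine ⟨fun i => (w i)⁻¹, hd, ?_⟩
    have h := lagrangian_le_posPart hK hd hQ.1 rfl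
    simp only [inv_inv] at h
    refine h.2 (le_antisymm h.1 (hw _ ?_))
    have hX := (Matrix.nonneg_iff_posSemidef.mp (CFC.posPart_nonneg
      (K * Matrix.diagonal (fun i => (((w i)⁻¹ : ℝ) : ℂ)) * K - 1))).conjTranspose_mul_mul_same K⁻¹
    rwa [hK.inv.1.eq] at hX

theorem feasibleCov_subset_posSemidef (Ptot : ℝ) (P : Fin n → ℝ) :
    feasibleCov Ptot P ⊆ {Q | Q.PosSemidef} :=
  fun _ hQ => hQ.1

theorem feasibleCov_nonempty {Ptot : ℝ} {P : Fin n → ℝ} (hPtot : 0 ≤ Ptot) (hP : ∀ i, 0 ≤ P i) :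
    (feasibleCov Ptot P).Nonempty :=
  ⟨0, Matrix.PosSemidef.zero, by simpa using hPtot, fun i => by simpa using hP i⟩

end Fin

/-! ### The reduced problem as a restriction of the original -/

section Reduced
variable {nR nT : ℕ} {H : Matrix (Fin nR) (Fin nT) ℂ}

theorem posSemidef_reducedCov (hK : (gramSqrt H).PosDef) (d : Fin nT → ℝ) :
    (reducedCov H d).PosSemidef := by
  have hX := (Matrix.nonneg_iff_posSemidef.mp (CFC.posPart_nonneg
    (gramSqrt H * Matrix.diagonal (fun i => (d i : ℂ)) * gramSqrt H - 1))).conjTranspose_mul_mul_same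
      (gramSqrt H)⁻¹
  rwa [hK.inv.1.eq] at hX

theorem mutualInfo_reducedCov (hK : (gramSqrt H).PosDef) (d : Fin nT → ℝ) :
    mutualInfo H (reducedCov H d) = - reducedObjective H d := by
  rw [mutualInfo_eq_logDetCongr, logDetCongr, reducedCov, congr_inv_congr hK, reducedObjective,
    neg_neg]

theorem reducedCov_mem_feasibleCov (hK : (gramSqrt H).PosDef) {Ptot : ℝ} {P d : Fin nT → ℝ}
    (hd : d ∈ reducedFeasible H Ptot P) : reducedCov H d ∈ feasibleCov Ptot P :=
  ⟨posSemidef_reducedCov hK d, hd.2.1.le, hd.2.2⟩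

end Reduced

end MIMO

theorem theorem1 (nR nT : ℕ) (H : Matrix (Fin nR) (Fin nT) ℂ) (hH : H.rank = nT)
    (Ptot : ℝ) (P : Fin nT → ℝ) (hPtot : 0 ≤ Ptot) (hP : ∀ i, 0 < P i)
    (hsum : Ptot ≤ ∑ i, P i) :
    ∃ Qopt : Matrix (Fin nT) (Fin nT) ℂ,
      MIMO.IsCapacityAchieving H Ptot P Qopt ∧
      (∀ Q, MIMO.IsCapacityAchieving H Ptot P Q → Q = Qopt) ∧
      Qopt.trace.re = Ptot ∧
      (∃ d, MIMO.IsReducedSolution H Ptot P d) ∧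
      ∀ d, MIMO.IsReducedSolution H Ptot P d →
        Qopt = MIMO.reducedCov H d ∧
        MIMO.mutualInfo H Qopt = - MIMO.reducedObjective H d := by
  have hK := MIMO.posDef_gramSqrt hH
  have hf : MIMO.mutualInfo H = MIMO.logDetCongr (MIMO.gramSqrt H) :=
    funext (MIMO.mutualInfo_eq_logDetCongr H)
  have hpsd := MIMO.feasibleCov_subset_posSemidef Ptot P
  have hne := MIMO.feasibleCov_nonempty hPtot fun i => (hP i).le
  obtain ⟨Q, hQ, hmax⟩ := (MIMO.isCompact_feasibleCov Ptot P).exists_isMaxOn hne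
    ((MIMO.continuousOn_logDetCongr hK).mono hpsd)
  have huniq : ∀ R, MIMO.IsCapacityAchieving H Ptot P R → R = Q := fun R hR =>
    MIMO.isMaxOn_logDetCongr_unique hK (MIMO.convex_feasibleCov Ptot P) hpsd hR.1 (hf ▸ hR.2)
      hQ hmax
  have htr := MIMO.trace_eq_of_isMaxOn hK hsum hQ hmax
  obtain ⟨d, hd, hQd⟩ := MIMO.exists_diagonal_of_isMaxOn hK hPtot hP hsum hQ hmax
  change Q = MIMO.reducedCov H d at hQd
  rw [← hf] at hmax
  have hdf : d ∈ MIMO.reducedFeasible H Ptot P :=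
    ⟨hd, hQd ▸ htr, fun i => hQd ▸ hQ.2.2 i⟩
  refine ⟨Q, ⟨hQ, hmax⟩, huniq, htr, ⟨d, hdf, fun e he => ?_⟩, fun e he => ?_⟩
  · have h : MIMO.mutualInfo H (MIMO.reducedCov H e) ≤ MIMO.mutualInfo H Q :=
      hmax (MIMO.reducedCov_mem_feasibleCov hK he)
    rw [hQd, MIMO.mutualInfo_reducedCov hK, MIMO.mutualInfo_reducedCov hK] at h
    exact neg_le_neg_iff.mp h
  · have h1 : MIMO.reducedObjective H e ≤ MIMO.reducedObjective H d := he.2 hdf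
    have h2 := MIMO.mutualInfo_reducedCov hK d
    have h3 := MIMO.mutualInfo_reducedCov hK e
    rw [← hQd] at h2
    -- The covariance of `e` is feasible and does at least as well as that of `d`, which is `Q`;
    -- uniqueness applies.
    have hQe : MIMO.reducedCov H e = Q := by
      refine huniq _ ⟨MIMO.reducedCov_mem_feasibleCov hK he.1, fun R hR => ?_⟩
      have h4 : MIMO.mutualInfo H R ≤ MIMO.mutualInfo H Q := hmax hR
      change MIMO.mutualInfo H R ≤ MIMO.mutualInfo H (MIMO.reducedCov H e)
      linarith
    exact ⟨hQe.symm, hQe ▸ h3⟩
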